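/- Let $(\mathsf E,\mathscr E)$ be a measurable space, $\mu$ a probability measure on it, and $T$ a $\mu$-invariant Markov kernel on $\mathsf E$, viewed as the bounded operator $Tf(x)=\int f(y)\,T(x,\mathrm dy)$ on the real Hilbert space $\mathrm L^2(\mu)$. Write $\mathrm L^2_0(\mu)=\{f\in \mathrm L^2(\mu):\mu(f)=0\}$, $\mathcal E(T,f)=\langle(\mathrm{Id}-T)f,f\rangle$, $\|f\|_{\mathrm{osc}}=\operatorname{ess\,sup}_\mu f-\operatorname{ess\,inf}_\mu f\in[0,\infty]$ and $\mathfrak a=\sup\{\|f\|_2^2/\|f\|_{\mathrm{osc}}^2: f\in \mathrm L^2_0(\mu)\setminus\{0\}\}$ (with $\mathfrak a=0$ if $\mathrm L^2_0(\mu)=\{0\}$). The kernel $T$ satisfies a $\|\cdot\|_{\mathrm{osc}}^2$-weak Poincaré inequality (WPI) - in the $\alpha$-parametrization, if there is a decreasing (i.e. nonincreasing) $\alpha:(0,\infty)\to[0,\infty)$ with $\|f\|_2^2\le\alpha(r)\,\mathcal E(T,f)+r\,\|f\|_{\mathrm{osc}}^2$ for all $r>0$, $f\in \mathrm L_0^2(\mu)$;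 - in the $\beta$-parametrization, if there is a decreasing (i.e. nonincreasing) $\beta:(0,\infty)\to[0,\infty)$ with $\beta(s)\to0$ as $s\to\infty$ and $\|f\|_2^2\le s\,\mathcal E(T,f)+\beta(s)\,\|f\|_{\mathrm{osc}}^2$ for all $s>0$, $f\in \mathrm L_0^2(\mu)$ (with the convention $0\cdot\infty=0$); - in the $K^*$-parametrization, if there is a nonnegative, convex, strictly increasing $K^*:[0,\mathfrak a]\to[0,\infty)$ with $K^*(0)=0$ and $\mathcal E(T,f)/\|f\|_{\mathrm{osc}}^2\ge K^*\big(\|f\|_2^2/\|f\|_{\mathrm{osc}}^2\big)$ for all $f\in \mathrm L_0^2(\mu)$ with $0<\|f\|_{\mathrm{osc}}<\infty$. A bounded operator $Q$ on $\mathrm L^2(\mu)$ is uniform-positivity-improving (UPI) if for each $\epsilon>0$, $\inf\{\langle\mathbf 1_A,Q\mathbf 1_B\rangle: A,B\in\mathscr E,\ \mu(A)\wedge\mu(B)\ge\epsilon\}>0$ (where $\inf\emptyset=+\infty$). The kernel $T$ is resolvent-uniform-positivity-improving (RUPI) if for some $0<\lambda<1$ the resolvent $R(\lambda,T)=\sum_{n\ge0}\lambda^nT^n$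 is UPI. **Theorem.** $T$ satisfies a $\|\cdot\|_{\mathrm{osc}}^2$-WPI if and only if $T$ is RUPI. This holds for the WPI in each of the three parametrizations: for each of them, some $\alpha$ (respectively $\beta$, $K^*$) as above exists if and only if $T$ is RUPI. Moreover, $T$ is RUPI if and only if $R(\lambda,T)$ is UPI for all $0<\lambda<1$. -/

import Mathlib

open MeasureTheory ProbabilityTheory Set
open scoped ENNReal RealInnerProductSpace

namespace WeakPoincare

variable {E : Type*} [MeasurableSpace E] {μ : Measure E}

/-! ### The bounded operator on `L²(μ)` given by a `μ`-invariant Markov kernel -/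

/-- Jensen's inequality for a Markov kernel: the function `x ↦ ∫ f(y) T(x, dy)` has `L²(μ)`-norm at
most that of `f`. -/
theorem eLpNorm_integral_kernel_le (T : Kernel E E) [IsMarkovKernel T] (hT : T.Invariant μ)
    {f : E → ℝ} (hf : StronglyMeasurable f) :
    eLpNorm (fun x => ∫ y, f y ∂(T x)) 2 μ ≤ eLpNorm f 2 μ := by
  have key : ∀ x, ‖∫ y, f y ∂(T x)‖ₑ ^ (2 : ℝ) ≤ ∫⁻ y, ‖f y‖ₑ ^ (2 : ℝ) ∂(T x) := by
    intro x
    have h1 : ‖∫ y, f y ∂(T x)‖ₑ ≤ eLpNorm f 2 (T x) := by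
      refine (enorm_integral_le_lintegral_enorm f).trans ?_
      rw [← eLpNorm_one_eq_lintegral_enorm]
      exact eLpNorm_le_eLpNorm_of_exponent_le (by norm_num) hf.aestronglyMeasurable
    have h2 := ENNReal.rpow_le_rpow h1 (show (0 : ℝ) ≤ 2 by norm_num)
    refine h2.trans (le_of_eq ?_)
    rw [eLpNorm_eq_lintegral_rpow_enorm_toReal (by norm_num) (by norm_num), ← ENNReal.rpow_mul]
    norm_num
  rw [eLpNorm_eq_lintegral_rpow_enorm_toReal (by norm_num) (by norm_num),
    eLpNorm_eq_lintegral_rpow_enorm_toReal (by norm_num) (by norm_num)]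
  refine ENNReal.rpow_le_rpow ?_ (by norm_num)
  have hm : Measurable fun y => ‖f y‖ₑ ^ (2 : ℝ) := hf.measurable.enorm.pow_const _
  calc ∫⁻ x, ‖∫ y, f y ∂(T x)‖ₑ ^ (2 : ℝ≥0∞).toReal ∂μ
      ≤ ∫⁻ x, ∫⁻ y, ‖f y‖ₑ ^ (2 : ℝ) ∂(T x) ∂μ := lintegral_mono fun x => by simpa using key x
    _ = ∫⁻ y, ‖f y‖ₑ ^ (2 : ℝ) ∂(μ.bind T) :=
        (Measure.lintegral_bind T.aemeasurable hm.aemeasurable).symm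
    _ = ∫⁻ y, ‖f y‖ₑ ^ (2 : ℝ≥0∞).toReal ∂μ := by rw [hT.def]; simp

theorem memLp_integral_kernel (T : Kernel E E) [IsMarkovKernel T] (hT : T.Invariant μ)
    (f : Lp ℝ 2 μ) : MemLp (fun x => ∫ y, f y ∂(T x)) 2 μ :=
  ⟨(Lp.stronglyMeasurable f).integral_kernel.aestronglyMeasurable,
    (eLpNorm_integral_kernel_le T hT (Lp.stronglyMeasurable f)).trans_lt (Lp.memLp f).2⟩

/-- By invariance, a property that holds `μ`-a.e. holds `T(x, ·)`-a.e. for `μ`-a.e. `x`. -/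
theorem ae_ae_kernel_of_ae (T : Kernel E E) (hT : T.Invariant μ) {p : E → Prop}
    (h : ∀ᵐ y ∂μ, p y) : ∀ᵐ x ∂μ, ∀ᵐ y ∂(T x), p y := by
  rw [← hT.def] at h
  exact Measure.ae_ae_of_ae_comp h

theorem ae_integrable_kernel [IsProbabilityMeasure μ] (T : Kernel E E) [IsMarkovKernel T] (hT : T.Invariant μ)
    (f : Lp ℝ 2 μ) : ∀ᵐ x ∂μ, Integrable f (T x) := by
  have hm : Measurable fun y => ‖f y‖ₑ := (Lp.stronglyMeasurable f).measurable.enorm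
  have hi : ∫⁻ y, ‖f y‖ₑ ∂μ < ∞ := ((Lp.memLp f).integrable (by norm_num)).hasFiniteIntegral
  have hfin : ∫⁻ x, ∫⁻ y, ‖f y‖ₑ ∂(T x) ∂μ ≠ ∞ := by
    rw [← Measure.lintegral_bind T.aemeasurable hm.aemeasurable, hT.def]
    exact hi.ne
  filter_upwards [ae_lt_top hm.lintegral_kernel hfin] with x hx
  exact ⟨(Lp.stronglyMeasurable f).aestronglyMeasurable, hx⟩

/-- The operator `(T f)(x) = ∫ f(y) T(x, dy)` on `L²(μ)` of a `μ`-invariant Markov kernel `T`. -/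
noncomputable def markovOp [IsProbabilityMeasure μ] (T : Kernel E E) [IsMarkovKernel T] (hT : T.Invariant μ) :
    Lp ℝ 2 μ →L[ℝ] Lp ℝ 2 μ :=
  LinearMap.mkContinuous
    { toFun := fun f => (memLp_integral_kernel T hT f).toLp (fun x => ∫ y, f y ∂(T x))
      map_add' := fun f g => by
        rw [← MemLp.toLp_add]
        refine MemLp.toLp_congr _ _ ?_
        filter_upwards [ae_integrable_kernel T hT f, ae_integrable_kernel T hT g,
          ae_ae_kernel_of_ae T hT (Lp.coeFn_add f g)] with x hf hg hfg
        rw [integral_congr_ae hfg]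
        exact integral_add hf hg
      map_smul' := fun c f => by
        rw [RingHom.id_apply, ← MemLp.toLp_const_smul]
        refine MemLp.toLp_congr _ _ ?_
        filter_upwards [ae_ae_kernel_of_ae T hT (Lp.coeFn_smul c f)] with x hf
        rw [integral_congr_ae hf]
        exact integral_const_mul c _ }
    1 fun f => by
      rw [one_mul]
      change ‖(memLp_integral_kernel T hT f).toLp _‖ ≤ ‖f‖
      rw [Lp.norm_toLp, Lp.norm_def]
      exact ENNReal.toReal_mono (Lp.eLpNorm_ne_top f)
        (eLpNorm_integral_kernel_le T hT (Lp.stronglyMeasurable f))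

/-! ### Weak Poincaré inequalities -/

/-- `L²₀(μ)`: the square-integrable functions of mean zero. -/
def L2zero (μ : Measure E) : Set (Lp ℝ 2 μ) := {f | ∫ x, f x ∂μ = 0}

/-- The Dirichlet form `⟨(Id - A) f, f⟩` of a bounded operator on `L²(μ)`. -/
noncomputable def dirichletForm (A : Lp ℝ 2 μ →L[ℝ] Lp ℝ 2 μ) (f : Lp ℝ 2 μ) : ℝ :=
  ⟪f - A f, f⟫

/-- The oscillation `ess sup f - ess inf f ∈ [0, ∞]`, computed in the extended reals. -/
noncomputable def oscNorm (μ : Measure E) (f : E → ℝ) : ℝ≥0∞ :=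
  (essSup (fun x => (f x : EReal)) μ - essInf (fun x => (f x : EReal)) μ).toENNReal

/-- The sieve `f ↦ ‖f‖²_osc` on `L²(μ)`. -/
noncomputable def oscSq (μ : Measure E) (f : Lp ℝ 2 μ) : ℝ≥0∞ := oscNorm μ f ^ 2

/-- The constant `𝔞 = sup {‖f‖₂² / Ψ(f) : f ∈ L²₀(μ), f ≠ 0}` of a sieve `Ψ`. -/
noncomputable def sieveConst (Ψ : Lp ℝ 2 μ → ℝ≥0∞) : ℝ≥0∞ :=
  ⨆ f ∈ {f | f ∈ L2zero μ ∧ f ≠ 0}, ENNReal.ofReal (‖f‖ ^ 2) / Ψ f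

/-- The `(Ψ, α)`-weak Poincaré inequality, for a decreasing `α : (0, ∞) → [0, ∞)`. Both sides are
read in `[0, ∞]`. -/
def AlphaWPI (A : Lp ℝ 2 μ →L[ℝ] Lp ℝ 2 μ) (Ψ : Lp ℝ 2 μ → ℝ≥0∞) (α : ℝ → ℝ) : Prop :=
  (∀ r, 0 < r → 0 ≤ α r) ∧ AntitoneOn α (Ioi 0) ∧
    ∀ r, 0 < r → ∀ f ∈ L2zero μ,
      ENNReal.ofReal (‖f‖ ^ 2) ≤
        ENNReal.ofReal (α r * dirichletForm A f) + ENNReal.ofReal r * Ψ f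

/-- The `(Ψ, β)`-weak Poincaré inequality, for a decreasing `β : (0, ∞) → [0, ∞)` that tends to `0`
at infinity. Both sides are read in `[0, ∞]`. -/
def BetaWPI (A : Lp ℝ 2 μ →L[ℝ] Lp ℝ 2 μ) (Ψ : Lp ℝ 2 μ → ℝ≥0∞) (β : ℝ → ℝ) : Prop :=
  (∀ s, 0 < s → 0 ≤ β s) ∧ AntitoneOn β (Ioi 0) ∧
    Filter.Tendsto β Filter.atTop (nhds 0) ∧
    ∀ s, 0 < s → ∀ f ∈ L2zero μ,
      ENNReal.ofReal (‖f‖ ^ 2) ≤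
        ENNReal.ofReal (s * dirichletForm A f) + ENNReal.ofReal (β s) * Ψ f

/-- The `(Ψ, K*)`-weak Poincaré inequality, for a nonnegative, convex, strictly increasing `K` on
`[0, 𝔞]` with `K 0 = 0`. The right end point is included because the ratio `‖f‖₂² / Ψ(f)` may attain
its supremum `𝔞`. -/
def KStarWPI (A : Lp ℝ 2 μ →L[ℝ] Lp ℝ 2 μ) (Ψ : Lp ℝ 2 μ → ℝ≥0∞) (K : ℝ → ℝ) : Prop :=
  (∀ v ∈ Icc 0 (sieveConst Ψ).toReal, 0 ≤ K v) ∧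
    ConvexOn ℝ (Icc 0 (sieveConst Ψ).toReal) K ∧
    StrictMonoOn K (Icc 0 (sieveConst Ψ).toReal) ∧ K 0 = 0 ∧
    ∀ f ∈ L2zero μ, 0 < Ψ f → Ψ f < ∞ →
      K (‖f‖ ^ 2 / (Ψ f).toReal) ≤ dirichletForm A f / (Ψ f).toReal

/-! ### Uniform positivity improvement -/

/-- The indicator function of a measurable set as an element of `L²(μ)`. -/
noncomputable def ind (μ : Measure E) [IsProbabilityMeasure μ] {A : Set E} (hA : MeasurableSet A) :
    Lp ℝ 2 μ :=
  indicatorConstLp 2 hA (measure_ne_top μ A) (1 : ℝ)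

/-- `Q` is uniform-positivity-improving: for each `ε > 0`, the infimum of `⟨1_A, Q 1_B⟩` over all
measurable `A`, `B` with `min (μ A) (μ B) ≥ ε` is positive (the infimum over the empty family,
which occurs for `ε > 1`, being `+∞`). -/
def IsUPI [IsProbabilityMeasure μ] (Q : Lp ℝ 2 μ →L[ℝ] Lp ℝ 2 μ) : Prop :=
  ∀ ε : ℝ, 0 < ε → ∃ δ : ℝ, 0 < δ ∧
    ∀ (A B : Set E) (hA : MeasurableSet A) (hB : MeasurableSet B),
      ε ≤ min (μ.real A) (μ.real B) → δ ≤ ⟪ind μ hA, Q (ind μ hB)⟫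

/-- The resolvent `R(l, A) = ∑ₙ lⁿ Aⁿ`, the sum being taken in operator norm. -/
noncomputable def resolventOp (l : ℝ) (A : Lp ℝ 2 μ →L[ℝ] Lp ℝ 2 μ) :
    Lp ℝ 2 μ →L[ℝ] Lp ℝ 2 μ :=
  ∑' n : ℕ, l ^ n • A ^ n

/-- For the operator of a `μ`-invariant Markov kernel the series defining the resolvent converges. -/
theorem summable_resolventOp [IsProbabilityMeasure μ] (T : Kernel E E) [IsMarkovKernel T] (hT : T.Invariant μ) {l : ℝ}
    (h0 : 0 < l) (h1 : l < 1) : Summable fun n : ℕ => l ^ n • markovOp T hT ^ n := by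
  have hn : ‖l • markovOp T hT‖ < 1 := by
    have h : ‖markovOp T hT‖ ≤ 1 := LinearMap.mkContinuous_norm_le _ zero_le_one _
    rw [norm_smul, Real.norm_of_nonneg h0.le]
    nlinarith [norm_nonneg (markovOp T hT)]
  simpa only [smul_pow] using summable_geometric_of_norm_lt_one hn

/-- `A` is resolvent-uniform-positivity-improving: for some `0 < l < 1` the resolvent `R(l, A)` is
uniform-positivity-improving. -/
def IsRUPI [IsProbabilityMeasure μ] (A : Lp ℝ 2 μ →L[ℝ] Lp ℝ 2 μ) : Prop :=
  ∃ l : ℝ, 0 < l ∧ l < 1 ∧ IsUPI (resolventOp l A)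

end WeakPoincare

namespace WeakPoincare

variable {E : Type*} [MeasurableSpace E] {μ : Measure E}

/-! ### The stationary two-step law -/

/-! Every condition is compared with `HasUniformFlow`: the stationary flow `(μ ⊗ₘ T)(A × Aᶜ)` is
bounded below uniformly over all `A` with `μ(A), μ(Aᶜ) ≥ ε`. This property does not mention `l`,
which is why positivity improvement for one `l` yields it for all of them. Reversibility is never
needed, because both marginals of `μ ⊗ₘ T` are `μ`.

From a WPI to flow: the centred indicator of `A` has squared norm `μ(A)μ(Aᶜ)`, oscillation 1 and
Dirichlet form equal to the flow out of `A`. The inequality tested on it is therefore a lower bound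
for the flow.

From flow to a WPI (`HasUniformFlow.exists_norm_sq_le`), a Cheeger-type argument: the flow bound
compares the probabilities that `A` separates a pair drawn from `μ × μ` and a pair drawn from `μ ⊗ₘ
T`. Applied to superlevel sets of `f` and integrated over the level, it compares the means of `|f(x)
- f(y)|`. Bounded oscillation passes from squares to absolute values on the variance side, and
Young's inequality passes back to squares on the energy side. The three parametrizations then follow
by optimizing constants and by a Legendre-type transform.

From a positivity-improving resolvent to flow: `g = R 1_{Aᶜ}` is bounded and satisfies `g = l T g`
on `A`. By invariance, mass of `g` on `A` can be sustained only by flow out of `A`.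

From flow to a positivity-improving resolvent: `g = R 1_B` is at least 1 on `B`, and `g ≥ l T g`.
Lowering the level by a fixed factor enlarges the superlevel set by a fixed amount
(`measureReal_superlevel_growth`), so finitely many steps exhaust all but a small part of the space.
-/

theorem measurePreserving_fst_compProd [IsProbabilityMeasure μ] (T : Kernel E E)
    [IsMarkovKernel T] : MeasurePreserving Prod.fst (μ ⊗ₘ T) μ :=
  ⟨measurable_fst, Measure.fst_compProd μ T⟩

theorem measurePreserving_snd_compProd [IsProbabilityMeasure μ] (T : Kernel E E)
    [IsMarkovKernel T] (hT : T.Invariant μ) : MeasurePreserving Prod.snd (μ ⊗ₘ T) μ :=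
  ⟨measurable_snd, (Measure.snd_compProd μ T).trans hT.def⟩

theorem integrable_coupling_mul {ρ : Measure (E × E)} (h₁ : MeasurePreserving Prod.fst ρ μ)
    (h₂ : MeasurePreserving Prod.snd ρ μ) {f g : E → ℝ} (hf : MemLp f 2 μ) (hg : MemLp g 2 μ) :
    Integrable (fun p : E × E => f p.1 * g p.2) ρ :=
  (hf.comp_measurePreserving h₁).integrable_mul (hg.comp_measurePreserving h₂)

theorem integral_comp_measurePreserving {F : Type*} [MeasurableSpace F] {ρ : Measure F}
    {π : F → E} (h : MeasurePreserving π ρ μ) {f : E → ℝ} (hf : AEStronglyMeasurable f μ) :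
    ∫ p, f (π p) ∂ρ = ∫ x, f x ∂μ := by
  obtain ⟨hm, rfl⟩ := h
  exact (integral_map hm.aemeasurable hf).symm

theorem coeFn_markovOp [IsProbabilityMeasure μ] (T : Kernel E E) [IsMarkovKernel T]
    (hT : T.Invariant μ) (f : Lp ℝ 2 μ) :
    markovOp T hT f =ᵐ[μ] fun x => ∫ y, f y ∂(T x) :=
  (memLp_integral_kernel T hT f).coeFn_toLp

theorem inner_markovOp [IsProbabilityMeasure μ] (T : Kernel E E) [IsMarkovKernel T]
    (hT : T.Invariant μ) (h g : Lp ℝ 2 μ) :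
    ⟪h, markovOp T hT g⟫ = ∫ p, h p.1 * g p.2 ∂(μ ⊗ₘ T) := by
  rw [Measure.integral_compProd (integrable_coupling_mul (measurePreserving_fst_compProd T)
    (measurePreserving_snd_compProd T hT) (Lp.memLp h) (Lp.memLp g)), L2.inner_def]
  refine integral_congr_ae ?_
  filter_upwards [coeFn_markovOp T hT g] with x hx
  rw [hx, integral_const_mul]
  simp [mul_comm]

theorem integrable_coupling_sq_sub {ρ : Measure (E × E)} (h₁ : MeasurePreserving Prod.fst ρ μ)
    (h₂ : MeasurePreserving Prod.snd ρ μ) {f : E → ℝ} (hf : MemLp f 2 μ) :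
    Integrable (fun p : E × E => (f p.1 - f p.2) ^ 2) ρ :=
  ((hf.comp_measurePreserving h₁).sub (hf.comp_measurePreserving h₂)).integrable_sq

theorem norm_sq_eq_integral_sq (f : Lp ℝ 2 μ) : ‖f‖ ^ 2 = ∫ x, f x ^ 2 ∂μ := by
  rw [← real_inner_self_eq_norm_sq, L2.inner_def]
  simp [sq]

/-- Expanding the square needs only the two marginals. The coupling `μ ⊗ₘ T` gives the Dirichlet
form and `μ.prod μ` the variance, so the two become directly comparable. -/
theorem integral_coupling_sq_sub {ρ : Measure (E × E)} (h₁ : MeasurePreserving Prod.fst ρ μ)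
    (h₂ : MeasurePreserving Prod.snd ρ μ) (f : Lp ℝ 2 μ) :
    ∫ p, (f p.1 - f p.2) ^ 2 ∂ρ = 2 * (‖f‖ ^ 2 - ∫ p, f p.1 * f p.2 ∂ρ) := by
  have hf := Lp.memLp f
  have i1 : Integrable (fun p : E × E => f p.1 ^ 2) ρ :=
    (hf.comp_measurePreserving h₁).integrable_sq
  have i2 : Integrable (fun p : E × E => f p.2 ^ 2) ρ :=
    (hf.comp_measurePreserving h₂).integrable_sq
  have i3 := integrable_coupling_mul h₁ h₂ hf hf
  have hs : AEStronglyMeasurable (fun x => f x ^ 2) μ := hf.integrable_sq.aestronglyMeasurable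
  have e1 : ∫ p, f p.1 ^ 2 ∂ρ = ‖f‖ ^ 2 := by
    rw [norm_sq_eq_integral_sq, ← integral_comp_measurePreserving h₁ hs]
  have e2 : ∫ p, f p.2 ^ 2 ∂ρ = ‖f‖ ^ 2 := by
    rw [norm_sq_eq_integral_sq, ← integral_comp_measurePreserving h₂ hs]
  have e : ∀ p : E × E, (f p.1 - f p.2) ^ 2 = f p.1 ^ 2 + f p.2 ^ 2 - 2 * (f p.1 * f p.2) :=
    fun p => by ring
  simp only [e]
  have i12 : Integrable (fun p : E × E => f p.1 ^ 2 + f p.2 ^ 2) ρ := i1.add i2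
  rw [integral_sub i12 (i3.const_mul 2), integral_add i1 i2,
    integral_const_mul, e1, e2]
  ring

theorem two_mul_dirichletForm [IsProbabilityMeasure μ] (T : Kernel E E) [IsMarkovKernel T]
    (hT : T.Invariant μ) (f : Lp ℝ 2 μ) :
    2 * dirichletForm (markovOp T hT) f = ∫ p, (f p.1 - f p.2) ^ 2 ∂(μ ⊗ₘ T) := by
  rw [integral_coupling_sq_sub (measurePreserving_fst_compProd T)
    (measurePreserving_snd_compProd T hT), ← inner_markovOp T hT, dirichletForm, inner_sub_left,
    real_inner_self_eq_norm_sq, real_inner_comm]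

theorem dirichletForm_nonneg [IsProbabilityMeasure μ] (T : Kernel E E) [IsMarkovKernel T]
    (hT : T.Invariant μ) (f : Lp ℝ 2 μ) : 0 ≤ dirichletForm (markovOp T hT) f := by
  have h : 0 ≤ ∫ p, (f p.1 - f p.2) ^ 2 ∂(μ ⊗ₘ T) := integral_nonneg fun p => sq_nonneg _
  rw [← two_mul_dirichletForm T hT] at h
  linarith

theorem coeFn_ind [IsProbabilityMeasure μ] {A : Set E} (hA : MeasurableSet A) :
    ind μ hA =ᵐ[μ] A.indicator 1 := indicatorConstLp_coeFn

/-- The stationary flow from `A` to `B`. -/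
theorem inner_ind_markovOp_ind [IsProbabilityMeasure μ] (T : Kernel E E) [IsMarkovKernel T]
    (hT : T.Invariant μ) {A B : Set E} (hA : MeasurableSet A) (hB : MeasurableSet B) :
    ⟪ind μ hA, markovOp T hT (ind μ hB)⟫ = (μ ⊗ₘ T).real (A ×ˢ B) := by
  rw [inner_markovOp, ← integral_indicator_one (hA.prod hB)]
  refine integral_congr_ae ?_
  filter_upwards [(measurePreserving_fst_compProd T).quasiMeasurePreserving.ae (coeFn_ind hA),
    (measurePreserving_snd_compProd T hT).quasiMeasurePreserving.ae (coeFn_ind hB)] with p h1 h2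
  rw [h1, h2]
  by_cases ha : p.1 ∈ A <;> by_cases hb : p.2 ∈ B <;> simp [ha, hb, indicator]

theorem inner_ind_left [IsProbabilityMeasure μ] {A : Set E} (hA : MeasurableSet A)
    (g : Lp ℝ 2 μ) : ⟪ind μ hA, g⟫ = ∫ x in A, g x ∂μ :=
  L2.inner_indicatorConstLp_one hA _ g

/-- Sets that are neither small nor large have a uniformly positive stationary flow out of them. -/
def HasUniformFlow [IsProbabilityMeasure μ] (Q : Lp ℝ 2 μ →L[ℝ] Lp ℝ 2 μ) : Prop :=
  ∀ ε : ℝ, 0 < ε → ∃ c : ℝ, 0 < c ∧ ∀ (A : Set E) (hA : MeasurableSet A),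
    ε ≤ μ.real A → ε ≤ μ.real Aᶜ → c ≤ ⟪ind μ hA, Q (ind μ hA.compl)⟫

/-! ### The resolvent -/

theorem markovOp_nonneg [IsProbabilityMeasure μ] (T : Kernel E E) [IsMarkovKernel T]
    (hT : T.Invariant μ) {f : Lp ℝ 2 μ} (hf : 0 ≤ f) : 0 ≤ markovOp T hT f := by
  rw [← Lp.coeFn_nonneg] at hf ⊢
  filter_upwards [coeFn_markovOp T hT f, ae_ae_kernel_of_ae T hT hf] with x hx h
  rw [hx]
  exact integral_nonneg_of_ae h

theorem ind_nonneg [IsProbabilityMeasure μ] {A : Set E} (hA : MeasurableSet A) : 0 ≤ ind μ hA := by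
  rw [← Lp.coeFn_nonneg]
  filter_upwards [coeFn_ind hA] with x hx
  rw [hx]
  exact indicator_nonneg (fun _ _ => zero_le_one) x

theorem markovOp_ind_univ [IsProbabilityMeasure μ] (T : Kernel E E) [IsMarkovKernel T]
    (hT : T.Invariant μ) :
    markovOp T hT (ind μ MeasurableSet.univ) = ind μ MeasurableSet.univ := by
  refine Lp.ext ?_
  have h := coeFn_ind (μ := μ) (MeasurableSet.univ (α := E))
  filter_upwards [coeFn_markovOp T hT (ind μ MeasurableSet.univ), h,
    ae_ae_kernel_of_ae T hT h] with x hx h1 h2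
  rw [hx, h1, integral_congr_ae h2]
  simp

theorem markovOp_pow_nonneg [IsProbabilityMeasure μ] (T : Kernel E E) [IsMarkovKernel T]
    (hT : T.Invariant μ) {f : Lp ℝ 2 μ} (hf : 0 ≤ f) (n : ℕ) : 0 ≤ (markovOp T hT ^ n) f := by
  induction n with
  | zero => simpa using hf
  | succ n ih =>
    rw [pow_succ']
    exact markovOp_nonneg T hT ih

theorem resolventOp_nonneg [IsProbabilityMeasure μ] (T : Kernel E E) [IsMarkovKernel T]
    (hT : T.Invariant μ) {l : ℝ} (h0 : 0 < l) (h1 : l < 1) {f : Lp ℝ 2 μ} (hf : 0 ≤ f) :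
    0 ≤ resolventOp l (markovOp T hT) f := by
  have h := (summable_resolventOp T hT h0 h1).hasSum.mapL (ContinuousLinearMap.apply ℝ _ f)
  refine h.nonneg fun n => ?_
  have hn := markovOp_pow_nonneg T hT hf n
  change 0 ≤ l ^ n • (markovOp T hT ^ n) f
  rw [← Lp.coeFn_nonneg] at hn ⊢
  filter_upwards [hn, Lp.coeFn_smul (l ^ n) ((markovOp T hT ^ n) f)] with x h2 h3
  rw [h3]
  exact mul_nonneg (pow_nonneg h0.le n) h2

theorem norm_smul_markovOp_lt_one [IsProbabilityMeasure μ] (T : Kernel E E) [IsMarkovKernel T]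
    (hT : T.Invariant μ) {l : ℝ} (h0 : 0 < l) (h1 : l < 1) : ‖l • markovOp T hT‖ < 1 := by
  have h : ‖markovOp T hT‖ ≤ 1 := LinearMap.mkContinuous_norm_le _ zero_le_one _
  rw [norm_smul, Real.norm_of_nonneg h0.le]
  nlinarith [norm_nonneg (markovOp T hT)]

theorem resolventOp_eq_add [IsProbabilityMeasure μ] (T : Kernel E E) [IsMarkovKernel T]
    (hT : T.Invariant μ) {l : ℝ} (h0 : 0 < l) (h1 : l < 1) (f : Lp ℝ 2 μ) :
    resolventOp l (markovOp T hT) f = f + l • markovOp T hT (resolventOp l (markovOp T hT) f) := by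
  have h := mul_neg_geom_series (l • markovOp T hT) (norm_smul_markovOp_lt_one T hT h0 h1)
  simp only [smul_pow] at h
  have h' := congrArg (fun Q => Q f) h
  simp only [sub_mul, one_mul] at h'
  exact sub_eq_iff_eq_add.mp h'

theorem resolventOp_ind_univ [IsProbabilityMeasure μ] (T : Kernel E E) [IsMarkovKernel T]
    (hT : T.Invariant μ) {l : ℝ} (h0 : 0 < l) (h1 : l < 1) :
    resolventOp l (markovOp T hT) (ind μ MeasurableSet.univ) =
      (1 - l)⁻¹ • ind μ MeasurableSet.univ := by
  have h := geom_series_mul_neg (l • markovOp T hT) (norm_smul_markovOp_lt_one T hT h0 h1)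
  simp only [smul_pow] at h
  have h' : resolventOp l (markovOp T hT)
      (ind μ MeasurableSet.univ - l • markovOp T hT (ind μ MeasurableSet.univ)) =
        ind μ MeasurableSet.univ := congrArg (fun Q => Q (ind μ MeasurableSet.univ)) h
  rw [markovOp_ind_univ] at h'
  rw [eq_inv_smul_iff₀ (by linarith), ← map_smul, sub_smul, one_smul, h']

theorem ind_add_ind_compl [IsProbabilityMeasure μ] {A : Set E} (hA : MeasurableSet A) :
    ind μ hA + ind μ hA.compl = ind μ MeasurableSet.univ := by
  refine Lp.ext ?_
  filter_upwards [Lp.coeFn_add (ind μ hA) (ind μ hA.compl), coeFn_ind (μ := μ) hA,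
    coeFn_ind (μ := μ) hA.compl, coeFn_ind (μ := μ) MeasurableSet.univ] with x h1 h2 h3 h4
  rw [h1, Pi.add_apply, h2, h3, h4]
  by_cases h : x ∈ A <;> simp [h]

/-- `R 1_A` and `R 1_{Aᶜ}` are nonnegative and sum to `R 1`, which is the constant `(1 - l)⁻¹`
because `T 1 = 1`. -/
theorem resolventOp_ind_le [IsProbabilityMeasure μ] (T : Kernel E E) [IsMarkovKernel T]
    (hT : T.Invariant μ) {l : ℝ} (h0 : 0 < l) (h1 : l < 1) {A : Set E} (hA : MeasurableSet A) :
    ∀ᵐ x ∂μ, resolventOp l (markovOp T hT) (ind μ hA) x ≤ (1 - l)⁻¹ := by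
  have h := resolventOp_nonneg T hT h0 h1 (ind_nonneg (μ := μ) hA.compl)
  have h2 := resolventOp_ind_univ T hT h0 h1
  rw [← ind_add_ind_compl hA, map_add, ind_add_ind_compl hA] at h2
  have h3 : resolventOp l (markovOp T hT) (ind μ hA) ≤ (1 - l)⁻¹ • ind μ MeasurableSet.univ := by
    rw [← h2]; exact le_add_of_nonneg_right h
  rw [← Lp.coeFn_le] at h3
  filter_upwards [h3, Lp.coeFn_smul (1 - l)⁻¹ (ind μ (MeasurableSet.univ (α := E))),
    coeFn_ind (μ := μ) (MeasurableSet.univ (α := E))] with x a b c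
  rw [b, Pi.smul_apply, c] at a
  simpa using a

/-! ### Uniform flow and positivity improvement of the resolvent -/

theorem HasUniformFlow.of_isUPI_resolventOp [IsProbabilityMeasure μ] {T : Kernel E E}
    [IsMarkovKernel T] {hT : T.Invariant μ} {l : ℝ} (h0 : 0 < l) (h1 : l < 1)
    (h : IsUPI (resolventOp l (markovOp T hT))) : HasUniformFlow (markovOp T hT) := by
  intro ε hε
  obtain ⟨δ, hδ, H⟩ := h ε hε
  have hl : 0 < 1 - l := by linarith
  -- One factor `1 - l` comes from absorbing `l⟨1_A, g⟩` into the left side, the other from the sup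
  -- bound on `g`.
  refine ⟨(1 - l) ^ 2 * δ, by positivity, fun A hA h2 h3 => ?_⟩
  have hR := H A Aᶜ hA hA.compl (le_min h2 h3)
  set g := resolventOp l (markovOp T hT) (ind μ hA.compl) with hg
  have hg0 : 0 ≤ g := resolventOp_nonneg T hT h0 h1 (ind_nonneg hA.compl)
  rw [← Lp.coeFn_nonneg] at hg0
  have hg1 := resolventOp_ind_le T hT h0 h1 (μ := μ) hA.compl
  rw [← hg] at hg1
  have hfix : g = ind μ hA.compl + l • markovOp T hT g := resolventOp_eq_add T hT h0 h1 _
  have hdisj : ⟪ind μ hA, ind μ hA.compl⟫ = 0 := by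
    rw [ind, ind, L2.inner_indicatorConstLp_indicatorConstLp]
    simp
  have e1 : ⟪ind μ hA, g⟫ = l * ⟪ind μ hA, markovOp T hT g⟫ := by
    conv_lhs => rw [hfix]
    rw [inner_add_right, hdisj, inner_smul_right, zero_add]
  have p1 := measurePreserving_fst_compProd (μ := μ) T
  have p2 := measurePreserving_snd_compProd T hT
  -- Split by the endpoint of the transition: if it lies in `A`, dropping the condition on the start
  -- leaves `∫_A g dμ` by invariance; otherwise `g ≤ (1 - l)⁻¹` leaves the flow out of `A`.
  have e2 : ⟪ind μ hA, markovOp T hT g⟫ ≤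
      ⟪ind μ hA, g⟫ + (1 - l)⁻¹ * ⟪ind μ hA, markovOp T hT (ind μ hA.compl)⟫ := by
    have i0 : Integrable (fun x => ind μ hA x * g x) μ :=
      (Lp.memLp (ind μ hA)).integrable_mul (Lp.memLp g)
    have e3 : ⟪ind μ hA, g⟫ = ∫ p, ind μ hA p.2 * g p.2 ∂(μ ⊗ₘ T) := by
      rw [integral_comp_measurePreserving p2 i0.aestronglyMeasurable, L2.inner_def]
      simp [mul_comm]
    have i1 : Integrable (fun p : E × E => ind μ hA p.2 * g p.2) (μ ⊗ₘ T) :=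
      p2.integrable_comp_of_integrable i0
    have i2 := integrable_coupling_mul p1 p2 (Lp.memLp (ind μ hA)) (Lp.memLp (ind μ hA.compl))
    rw [e3, inner_markovOp, inner_markovOp, ← integral_const_mul,
      ← integral_add i1 (i2.const_mul _)]
    refine integral_mono_ae (integrable_coupling_mul p1 p2 (Lp.memLp _) (Lp.memLp _))
      (i1.add (i2.const_mul _)) ?_
    filter_upwards [p1.quasiMeasurePreserving.ae (coeFn_ind hA),
      p2.quasiMeasurePreserving.ae (coeFn_ind hA), p2.quasiMeasurePreserving.ae hg0,
      p2.quasiMeasurePreserving.ae (coeFn_ind hA.compl), p2.quasiMeasurePreserving.ae hg1]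
      with p a1 a2 a3 a4 a5
    have a3' : 0 ≤ g p.2 := a3
    rw [a1, a2, a4]
    by_cases ha : p.1 ∈ A <;> by_cases hb : p.2 ∈ A <;> simp [ha, hb, a3', a5]
  have e4 : ⟪ind μ hA, g⟫ * (1 - l) ≤
      l * (1 - l)⁻¹ * ⟪ind μ hA, markovOp T hT (ind μ hA.compl)⟫ := by
    nlinarith [mul_le_mul_of_nonneg_left e2 h0.le]
  have hk : 0 ≤ ⟪ind μ hA, markovOp T hT (ind μ hA.compl)⟫ := by
    rw [inner_ind_markovOp_ind]; exact measureReal_nonneg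
  have e5 : l * (1 - l)⁻¹ * ⟪ind μ hA, markovOp T hT (ind μ hA.compl)⟫ ≤
      (1 - l)⁻¹ * ⟪ind μ hA, markovOp T hT (ind μ hA.compl)⟫ := by
    have : 0 ≤ (1 - l)⁻¹ * ⟪ind μ hA, markovOp T hT (ind μ hA.compl)⟫ :=
      mul_nonneg (inv_nonneg.2 hl.le) hk
    nlinarith
  have e6 : δ * (1 - l) ≤ (1 - l)⁻¹ * ⟪ind μ hA, markovOp T hT (ind μ hA.compl)⟫ :=
    (mul_le_mul_of_nonneg_right hR hl.le).trans (e4.trans e5)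
  rw [inv_mul_eq_div, le_div_iff₀ hl] at e6
  linarith

/-- If `g` dominates `l • T g`, a superlevel set with a large complement grows when the level is
lowered by a fixed factor. -/
theorem measureReal_superlevel_growth [IsProbabilityMeasure μ] {T : Kernel E E}
    [IsMarkovKernel T] {hT : T.Invariant μ} {l c t : ℝ} (h0 : 0 < l) (h1 : l < 1) (hc : 0 < c)
    (hc1 : c ≤ 1) (ht : 0 < t) {g : Lp ℝ 2 μ} (hg0 : 0 ≤ g)
    (hg : l • markovOp T hT g ≤ g) (hA : MeasurableSet {x | g x < t})
    (hflow : c ≤ ⟪ind μ hA, markovOp T hT (ind μ hA.compl)⟫) :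
    μ.real {x | t ≤ g x} + l * c / 2 ≤ μ.real {x | l * c / 2 * t ≤ g x} := by
  have hmeas : Measurable g := (Lp.stronglyMeasurable g).measurable
  set s := l * c / 2 * t with hs
  have hlc : 0 < l * c := mul_pos h0 hc
  have hs0 : 0 < s := by positivity
  have hst : s ≤ t := by
    have : l * c ≤ 1 := mul_le_one₀ h1.le hc.le hc1
    rw [hs]
    nlinarith
  have hTg := markovOp_nonneg T hT hg0
  rw [← Lp.coeFn_nonneg] at hg0 hTg
  rw [← Lp.coeFn_le] at hg
  -- Since `g ≥ t 1_{g ≥ t}`, the bound `g ≥ l T g` makes the integral over `{g < t}` at least `l t`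
  -- times the flow from `{g < t}` to `{g ≥ t}`.
  have lower : l * c * t ≤ ∫ x in {x | g x < t}, g x ∂μ := by
    have m1 : t • ind μ hA.compl ≤ g := by
      rw [← Lp.coeFn_le]
      filter_upwards [hg0, Lp.coeFn_smul t (ind μ hA.compl), coeFn_ind hA.compl] with x a b d
      rw [b, Pi.smul_apply, d]
      by_cases hx : g x < t
      · simpa [hx] using a
      · have hx' : x ∈ {x | g x < t}ᶜ := hx
        rw [indicator_of_mem hx']
        simpa using not_lt.1 hx
    have m2 : 0 ≤ markovOp T hT (g - t • ind μ hA.compl) :=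
      markovOp_nonneg T hT (sub_nonneg.2 m1)
    have m3 : ∀ {h : Lp ℝ 2 μ}, 0 ≤ h → 0 ≤ ⟪ind μ hA, h⟫ := by
      intro h hh
      rw [← Lp.coeFn_nonneg] at hh
      rw [inner_ind_left]
      exact integral_nonneg_of_ae (ae_restrict_of_ae hh)
    have m4 := m3 m2
    have m5 := m3 (sub_nonneg.2 ((Lp.coeFn_le _ _).1 hg))
    rw [map_sub, map_smul, inner_sub_right, inner_smul_right] at m4
    rw [inner_sub_right, inner_smul_right] at m5
    rw [← inner_ind_left hA]
    nlinarith [mul_le_mul_of_nonneg_left hflow ht.le, mul_le_mul_of_nonneg_left m4 h0.le,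
      mul_le_mul_of_nonneg_left (mul_le_mul_of_nonneg_left hflow ht.le) h0.le]
  have hD : MeasurableSet {x | s ≤ g x ∧ g x < t} :=
    (measurableSet_le measurable_const hmeas).inter hA
  -- The level `s` is half the lower bound `l c t`, so the part of `g` below `s` accounts for at
  -- most half of it, and the rest forces mass on `{s ≤ g < t}`.
  have upper : ∫ x in {x | g x < t}, g x ∂μ ≤ t * μ.real {x | s ≤ g x ∧ g x < t} + s := by
    have hi : Integrable g μ := (Lp.memLp g).integrable (by norm_num)
    have hi2 : Integrable ({x | s ≤ g x ∧ g x < t}.indicator fun _ => t) μ :=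
      (integrable_const t).indicator hD
    rw [← integral_indicator hA]
    calc ∫ x, {x | g x < t}.indicator g x ∂μ
        ≤ ∫ x, ({x | s ≤ g x ∧ g x < t}.indicator (fun _ => t) x + s) ∂μ := by
          refine integral_mono (hi.indicator hA) (hi2.add (integrable_const s)) fun x => ?_
          by_cases h2 : g x < t
          · by_cases h3 : s ≤ g x
            · simp [indicator, h2, h3]; linarith
            · simp [indicator, h2, h3]; linarith
          · simp [indicator, h2, hs0.le]
      _ = t * μ.real {x | s ≤ g x ∧ g x < t} + s := by
          rw [integral_add hi2 (integrable_const s), integral_indicator_const _ hD]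
          simp [mul_comm]
  have hle : l * c / 2 ≤ μ.real {x | s ≤ g x ∧ g x < t} := by
    have : l * c / 2 * t ≤ μ.real {x | s ≤ g x ∧ g x < t} * t := by
      rw [← hs] ; nlinarith
    exact le_of_mul_le_mul_right this ht
  have hun : {x | s ≤ g x} = {x | t ≤ g x} ∪ {x | s ≤ g x ∧ g x < t} := by
    ext x
    constructor
    · intro h
      rcases le_or_gt t (g x) with h' | h'
      · exact Or.inl h'
      · exact Or.inr ⟨h, h'⟩
    · rintro (h | h)
      · exact hst.trans h
      · exact h.1
  rw [hun, measureReal_union _ hD]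
  · linarith
  · rw [Set.disjoint_left]
    exact fun x hx hx' => absurd hx'.2 (not_lt.2 hx)

theorem HasUniformFlow.isUPI_resolventOp [IsProbabilityMeasure μ] {T : Kernel E E}
    [IsMarkovKernel T] {hT : T.Invariant μ} {l : ℝ} (h0 : 0 < l) (h1 : l < 1)
    (h : HasUniformFlow (markovOp T hT)) : IsUPI (resolventOp l (markovOp T hT)) := by
  intro ε hε
  -- The threshold is `ε / 2` so that, once the sublevel set is smaller than that, any `A` of mass
  -- at least `ε` keeps mass `ε / 2` on the superlevel set.
  obtain ⟨c', hc', H'⟩ := h (ε / 2) (by positivity)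
  obtain ⟨c, hc, hc1, H⟩ : ∃ c : ℝ, 0 < c ∧ c ≤ 1 ∧ ∀ (A : Set E) (hA : MeasurableSet A),
      ε / 2 ≤ μ.real A → ε / 2 ≤ μ.real Aᶜ →
        c ≤ ⟪ind μ hA, markovOp T hT (ind μ hA.compl)⟫ :=
    ⟨min c' 1, lt_min hc' one_pos, min_le_right _ _, fun A hA h2 h3 =>
      (min_le_left _ _).trans (H' A hA h2 h3)⟩
  have hη : 0 < l * c / 2 := by positivity
  have hη1 : l * c / 2 ≤ 1 := by nlinarith
  -- After this many gains of `l c / 2` the superlevel set would have mass greater than 1.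
  obtain ⟨n, hn⟩ := exists_nat_gt (l * c / 2)⁻¹
  have hn' : 1 < n * (l * c / 2) := by rwa [inv_lt_iff_one_lt_mul₀ hη] at hn
  refine ⟨(l * c / 2) ^ n * (ε / 2), by positivity, fun A B hA hB hAB => ?_⟩
  set g := resolventOp l (markovOp T hT) (ind μ hB) with hg
  have hg0 : 0 ≤ g := resolventOp_nonneg T hT h0 h1 (ind_nonneg hB)
  have hfix : g = ind μ hB + l • markovOp T hT g := resolventOp_eq_add T hT h0 h1 _
  have hgT : l • markovOp T hT g ≤ g := by
    conv_rhs => rw [hfix]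
    exact le_add_of_nonneg_left (ind_nonneg hB)
  have hTg := markovOp_nonneg T hT hg0
  have hmeas : Measurable g := (Lp.stronglyMeasurable g).measurable
  have hlt : ∀ t : ℝ, MeasurableSet {x | g x < t} := fun t =>
    measurableSet_lt hmeas measurable_const
  have hcompl : ∀ t : ℝ, {x | g x < t}ᶜ = {x | t ≤ g x} := fun t => by ext x; simp
  have hB1 : ε ≤ μ.real {x | 1 ≤ g x} := by
    refine (hAB.trans (min_le_right _ _)).trans ?_
    refine ENNReal.toReal_mono (measure_ne_top _ _) (measure_mono_ae ?_)
    rw [← Lp.coeFn_nonneg] at hTg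
    have := Lp.coeFn_add (ind μ hB) (l • markovOp T hT g)
    rw [← hfix] at this
    filter_upwards [hTg, this, coeFn_ind hB, Lp.coeFn_smul l (markovOp T hT g)]
      with x a b d e hx
    have hx' : x ∈ B := hx
    have a' : 0 ≤ (markovOp T hT g) x := a
    change 1 ≤ g x
    rw [b, Pi.add_apply, d, e]
    simp [hx']
    positivity
  -- Either the sublevel set has become small, which persists since the levels decrease, or every
  -- step so far has gained mass. The superlevel set always keeps the initial `ε`, so the flow bound
  -- stays applicable.
  have key : ∀ k : ℕ, μ.real {x | g x < (l * c / 2) ^ k} < ε / 2 ∨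
      ε + k * (l * c / 2) ≤ μ.real {x | (l * c / 2) ^ k ≤ g x} := by
    intro k
    induction k with
    | zero => right; simpa using hB1
    | succ k ih =>
      rcases ih with ih | ih
      · left
        refine lt_of_le_of_lt (measureReal_mono fun x hx => ?_) ih
        have hx' : g x < (l * c / 2) ^ (k + 1) := hx
        exact hx'.trans_le (pow_le_pow_of_le_one hη.le hη1 (Nat.le_succ k))
      · by_cases hsm : μ.real {x | g x < (l * c / 2) ^ k} < ε / 2
        · left
          refine lt_of_le_of_lt (measureReal_mono fun x hx => ?_) hsm
          have hx' : g x < (l * c / 2) ^ (k + 1) := hx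
          exact hx'.trans_le (pow_le_pow_of_le_one hη.le hη1 (Nat.le_succ k))
        · right
          have hflow := H _ (hlt ((l * c / 2) ^ k)) (not_lt.1 hsm) (by
            rw [hcompl]
            have : 0 ≤ k * (l * c / 2) := by positivity
            linarith)
          have := measureReal_superlevel_growth h0 h1 hc hc1 (pow_pos hη k) hg0 hgT _ hflow
          rw [pow_succ']
          push_cast
          linarith
  have hsmall : μ.real {x | g x < (l * c / 2) ^ n} < ε / 2 := by
    refine (key n).resolve_right fun hbig => ?_
    have : μ.real {x | (l * c / 2) ^ n ≤ g x} ≤ 1 := measureReal_le_one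
    linarith
  have hAS : ε / 2 ≤ μ.real (A ∩ {x | (l * c / 2) ^ n ≤ g x}) := by
    have h2 : μ.real A ≤ μ.real (A ∩ {x | (l * c / 2) ^ n ≤ g x}) +
        μ.real {x | g x < (l * c / 2) ^ n} := by
      refine (measureReal_mono fun x hx => ?_).trans (measureReal_union_le _ _)
      rcases le_or_gt ((l * c / 2) ^ n) (g x) with h' | h'
      · exact Or.inl ⟨hx, h'⟩
      · exact Or.inr h'
    have := hAB.trans (min_le_left _ _)
    linarith
  rw [← Lp.coeFn_nonneg] at hg0
  have hi : Integrable g μ := (Lp.memLp g).integrable (by norm_num)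
  have hS : MeasurableSet (A ∩ {x | (l * c / 2) ^ n ≤ g x}) :=
    hA.inter (measurableSet_le measurable_const hmeas)
  rw [inner_ind_left hA]
  calc (l * c / 2) ^ n * (ε / 2)
      ≤ (l * c / 2) ^ n * μ.real (A ∩ {x | (l * c / 2) ^ n ≤ g x}) :=
        mul_le_mul_of_nonneg_left hAS (by positivity)
    _ ≤ ∫ x in A ∩ {x | (l * c / 2) ^ n ≤ g x}, g x ∂μ :=
        setIntegral_ge_of_const_le_real hS (measure_ne_top _ _) (fun x hx => hx.2) hi.integrableOn
    _ ≤ ∫ x in A, g x ∂μ :=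
        setIntegral_mono_set hi.integrableOn (ae_restrict_of_ae hg0)
          (Filter.Eventually.of_forall inter_subset_left)

/-! ### Oscillation and variance -/

theorem oscNorm_le_ofReal [IsProbabilityMeasure μ] {f : E → ℝ} {m M : ℝ}
    (h : ∀ᵐ x ∂μ, m ≤ f x ∧ f x ≤ M) : oscNorm μ f ≤ ENNReal.ofReal (M - m) := by
  have hM : essSup (fun x => (f x : EReal)) μ ≤ M :=
    essSup_le_of_ae_le _ (by filter_upwards [h] with x hx using EReal.coe_le_coe_iff.2 hx.2)
  have hm : (m : EReal) ≤ essInf (fun x => (f x : EReal)) μ :=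
    le_essInf_of_ae_le _ (by filter_upwards [h] with x hx using EReal.coe_le_coe_iff.2 hx.1)
  refine (EReal.toENNReal_le_toENNReal (EReal.sub_le_sub hM hm)).trans (le_of_eq ?_)
  rw [← EReal.coe_sub]
  rfl

theorem exists_bounds_of_oscNorm_ne_top [IsProbabilityMeasure μ] {f : E → ℝ}
    (h : oscNorm μ f ≠ ∞) : ∃ m M : ℝ, m ≤ M ∧ (∀ᵐ x ∂μ, m ≤ f x ∧ f x ≤ M) ∧
      oscNorm μ f = ENNReal.ofReal (M - m) := by
  have hu : ∀ᵐ x ∂μ, (f x : EReal) ≤ essSup (fun x => (f x : EReal)) μ := ae_le_essSup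
  have hv : ∀ᵐ x ∂μ, essInf (fun x => (f x : EReal)) μ ≤ f x := ae_essInf_le
  have huv := hu.and hv
  rw [oscNorm] at h ⊢
  generalize essSup (fun x => (f x : EReal)) μ = u at *
  generalize essInf (fun x => (f x : EReal)) μ = v at *
  obtain ⟨x, hx, hx'⟩ := huv.exists
  induction u with
  | bot => exact absurd hx (by simp)
  | top =>
    induction v with
    | bot => simp at h
    | top => exact absurd hx' (by simp)
    | coe m => simp at h
  | coe M =>
    induction v with
    | bot => simp at h
    | top => exact absurd hx' (by simp)
    | coe m =>
      refine ⟨m, M, EReal.coe_le_coe_iff.1 (hx'.trans hx), ?_, ?_⟩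
      · filter_upwards [huv] with y hy
        exact ⟨EReal.coe_le_coe_iff.1 hy.2, EReal.coe_le_coe_iff.1 hy.1⟩
      · rw [← EReal.coe_sub]
        rfl

theorem exists_bounds_of_oscSq_ne_top [IsProbabilityMeasure μ] {f : Lp ℝ 2 μ}
    (h : oscSq μ f ≠ ∞) : ∃ m M : ℝ, m ≤ M ∧ (∀ᵐ x ∂μ, m ≤ f x ∧ f x ≤ M) ∧
      oscSq μ f = ENNReal.ofReal ((M - m) ^ 2) := by
  have h' : oscNorm μ f ≠ ∞ := fun e => h (by simp [oscSq, e])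
  obtain ⟨m, M, hmM, hb, he⟩ := exists_bounds_of_oscNorm_ne_top h'
  exact ⟨m, M, hmM, hb, by rw [oscSq, he, ENNReal.ofReal_pow (sub_nonneg.2 hmM)]⟩

theorem measurePreserving_fst_prod [IsProbabilityMeasure μ] :
    MeasurePreserving Prod.fst (μ.prod μ) μ := measurePreserving_fst

theorem measurePreserving_snd_prod [IsProbabilityMeasure μ] :
    MeasurePreserving Prod.snd (μ.prod μ) μ := measurePreserving_snd

theorem two_mul_norm_sq [IsProbabilityMeasure μ] {f : Lp ℝ 2 μ} (hf : f ∈ L2zero μ) :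
    2 * ‖f‖ ^ 2 = ∫ p, (f p.1 - f p.2) ^ 2 ∂(μ.prod μ) := by
  have h0 : ∫ x, f x ∂μ = 0 := hf
  rw [integral_coupling_sq_sub measurePreserving_fst measurePreserving_snd,
    integral_prod_mul (fun x => f x) (fun x => f x), h0]
  simp

theorem norm_sq_le_oscSq [IsProbabilityMeasure μ] {f : Lp ℝ 2 μ} (hf : f ∈ L2zero μ) :
    ENNReal.ofReal (‖f‖ ^ 2) ≤ oscSq μ f := by
  by_cases h : oscSq μ f = ∞
  · simp [h]
  obtain ⟨m, M, hmM, hb, he⟩ := exists_bounds_of_oscSq_ne_top h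
  rw [he]
  refine ENNReal.ofReal_le_ofReal ?_
  have h2 : ∫ p, (f p.1 - f p.2) ^ 2 ∂(μ.prod μ) ≤ ∫ _, (M - m) ^ 2 ∂(μ.prod μ) := by
    refine integral_mono_ae (integrable_coupling_sq_sub measurePreserving_fst
      measurePreserving_snd (Lp.memLp f)) (integrable_const _) ?_
    filter_upwards [measurePreserving_fst_prod.quasiMeasurePreserving.ae hb,
      measurePreserving_snd_prod.quasiMeasurePreserving.ae hb] with p h1 h2
    exact sq_le_sq' (by linarith [h1.1, h2.2]) (by linarith [h1.2, h2.1])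
  rw [← two_mul_norm_sq hf] at h2
  simp only [integral_const, probReal_univ, smul_eq_mul, one_mul] at h2
  nlinarith [sq_nonneg (M - m)]

/-- Finiteness ensures that `toReal` in `KStarWPI` gives the true end point and not the default
value 0. -/
theorem sieveConst_oscSq_ne_top [IsProbabilityMeasure μ] : sieveConst (oscSq μ) ≠ ∞ := by
  refine ne_top_of_le_ne_top ENNReal.one_ne_top (iSup₂_le fun f hf => ?_)
  exact ENNReal.div_le_of_le_mul (by simpa using norm_sq_le_oscSq hf.1)

/-! ### From uniform flow to a weak Poincaré inequality -/

/-- Co-area formula: `|f(x) - f(y)|` is the length of the set of levels between the two values;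
apply Tonelli. -/
theorem lintegral_abs_sub_eq {ρ : Measure (E × E)} [SFinite ρ] {f : E → ℝ} (hf : Measurable f) :
    ∫⁻ p, ENNReal.ofReal |f p.1 - f p.2| ∂ρ =
      ∫⁻ t : ℝ, ρ {p | t ∈ uIoc (f p.1) (f p.2)} := by
  have hS : MeasurableSet {q : (E × E) × ℝ | q.2 ∈ uIoc (f q.1.1) (f q.1.2)} := by
    have hf1 : Measurable fun q : (E × E) × ℝ => f q.1.1 := by fun_prop
    have hf2 : Measurable fun q : (E × E) × ℝ => f q.1.2 := by fun_prop
    exact (measurableSet_lt (hf1.min hf2) measurable_snd).inter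
      (measurableSet_le measurable_snd (hf1.max hf2))
  have h1 := Measure.prod_apply (μ := ρ) (ν := (volume : Measure ℝ)) hS
  have h2 := Measure.prod_apply_symm (μ := ρ) (ν := (volume : Measure ℝ)) hS
  rw [h1] at h2
  refine Eq.trans (lintegral_congr fun p => ?_) h2
  rw [abs_sub_comm]
  exact (Real.volume_uIoc (a := f p.1) (b := f p.2)).symm

/-- If `A` and `Aᶜ` both have mass at least `ε / 2`, the flow is at least `c` and `C = c⁻¹` makes
the right side at least 1. Otherwise a separated pair has a coordinate in the smaller set, which has
probability at most `2 · ε / 2` under `μ × μ`. -/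
theorem measure_separated_le [IsProbabilityMeasure μ] {T : Kernel E E}
    [IsMarkovKernel T] {hT : T.Invariant μ} (h : HasUniformFlow (markovOp T hT)) {ε : ℝ}
    (hε : 0 < ε) : ∃ C : ℝ, 0 < C ∧ ∀ A : Set E, MeasurableSet A →
      (μ.prod μ) {p | ¬(p.1 ∈ A ↔ p.2 ∈ A)} ≤
        ENNReal.ofReal C * (μ ⊗ₘ T) {p | ¬(p.1 ∈ A ↔ p.2 ∈ A)} + ENNReal.ofReal ε := by
  obtain ⟨c, hc, H⟩ := h (ε / 2) (by positivity)
  refine ⟨c⁻¹, inv_pos.2 hc, fun A hA => ?_⟩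
  by_cases hs : ε / 2 ≤ μ.real A ∧ ε / 2 ≤ μ.real Aᶜ
  · have h1 := H A hA hs.1 hs.2
    rw [inner_ind_markovOp_ind] at h1
    have h2 : ENNReal.ofReal c ≤ (μ ⊗ₘ T) {p | ¬(p.1 ∈ A ↔ p.2 ∈ A)} := by
      rw [ENNReal.ofReal_le_iff_le_toReal (measure_ne_top _ _)]
      refine h1.trans (measureReal_mono fun p hp => ?_)
      have h3 : p.1 ∈ A := hp.1
      have h4 : p.2 ∉ A := hp.2
      simp [h3, h4]
    calc (μ.prod μ) {p | ¬(p.1 ∈ A ↔ p.2 ∈ A)} ≤ 1 := prob_le_one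
      _ = ENNReal.ofReal c⁻¹ * ENNReal.ofReal c := by
          rw [← ENNReal.ofReal_mul (inv_nonneg.2 hc.le), inv_mul_cancel₀ hc.ne',
            ENNReal.ofReal_one]
      _ ≤ ENNReal.ofReal c⁻¹ * (μ ⊗ₘ T) {p | ¬(p.1 ∈ A ↔ p.2 ∈ A)} := by gcongr
      _ ≤ _ := le_self_add
  · refine le_trans ?_ le_add_self
    have key : ∀ B : Set E, μ.real B < ε / 2 →
        (∀ p : E × E, ¬(p.1 ∈ A ↔ p.2 ∈ A) → p.1 ∈ B ∨ p.2 ∈ B) →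
        (μ.prod μ) {p | ¬(p.1 ∈ A ↔ p.2 ∈ A)} ≤ ENNReal.ofReal ε := by
      intro B hB hsub
      have hB' : μ B ≤ ENNReal.ofReal (ε / 2) := by
        rw [← ofReal_measureReal]
        exact ENNReal.ofReal_le_ofReal hB.le
      calc (μ.prod μ) {p | ¬(p.1 ∈ A ↔ p.2 ∈ A)}
          ≤ (μ.prod μ) (B ×ˢ univ ∪ univ ×ˢ B) := measure_mono fun p hp => by
            rcases hsub p hp with h | h
            · exact Or.inl ⟨h, mem_univ _⟩
            · exact Or.inr ⟨mem_univ _, h⟩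
        _ ≤ (μ.prod μ) (B ×ˢ univ) + (μ.prod μ) (univ ×ˢ B) := measure_union_le _ _
        _ = μ B + μ B := by simp [Measure.prod_prod]
        _ ≤ ENNReal.ofReal (ε / 2) + ENNReal.ofReal (ε / 2) := add_le_add hB' hB'
        _ = ENNReal.ofReal ε := by
            rw [← ENNReal.ofReal_add (by positivity) (by positivity), add_halves]
    rw [not_and_or, not_le, not_le] at hs
    rcases hs with hs | hs
    · exact key A hs fun p hp => by tauto
    · exact key Aᶜ hs fun p hp => by simp only [mem_compl_iff]; tauto

theorem lintegral_prod_abs_sub_le [IsProbabilityMeasure μ] {T : Kernel E E}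
    [IsMarkovKernel T] {ε C : ℝ}
    (hC : ∀ A : Set E, MeasurableSet A → (μ.prod μ) {p | ¬(p.1 ∈ A ↔ p.2 ∈ A)} ≤
        ENNReal.ofReal C * (μ ⊗ₘ T) {p | ¬(p.1 ∈ A ↔ p.2 ∈ A)} + ENNReal.ofReal ε)
    {f : E → ℝ} (hf : Measurable f) {m M : ℝ} (hb : ∀ᵐ x ∂μ, m ≤ f x ∧ f x ≤ M) :
    ∫⁻ p, ENNReal.ofReal |f p.1 - f p.2| ∂(μ.prod μ) ≤
      ENNReal.ofReal C * ∫⁻ p, ENNReal.ofReal |f p.1 - f p.2| ∂(μ ⊗ₘ T) +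
        ENNReal.ofReal ε * ENNReal.ofReal (M - m) := by
  -- The half-open interval matches `{t ≤ f}` exactly, ties included.
  have hset : ∀ t : ℝ, {p : E × E | t ∈ uIoc (f p.1) (f p.2)} =
      {p | ¬(p.1 ∈ {x | t ≤ f x} ↔ p.2 ∈ {x | t ≤ f x})} := by
    intro t
    ext p
    simp only [mem_ofPred_eq, mem_uIoc]
    grind
  rw [lintegral_abs_sub_eq hf, lintegral_abs_sub_eq hf,
    ← lintegral_const_mul' _ _ ENNReal.ofReal_ne_top, ← Real.volume_Icc,
    ← lintegral_indicator_const measurableSet_Icc,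
    ← lintegral_add_right _ (measurable_const.indicator measurableSet_Icc)]
  refine lintegral_mono fun t => ?_
  by_cases ht : t ∈ Icc m M
  · rw [indicator_of_mem ht, hset]
    exact hC _ (measurableSet_le measurable_const hf)
  -- Levels outside `[m, M]` separate almost no pair, so the error `ε` is paid only over a length `M
  -- - m`.
  · have : (μ.prod μ) {p | t ∈ uIoc (f p.1) (f p.2)} = 0 := by
      rw [measure_eq_zero_iff_ae_notMem]
      filter_upwards [measurePreserving_fst_prod.quasiMeasurePreserving.ae hb,
        measurePreserving_snd_prod.quasiMeasurePreserving.ae hb] with p h1 h2 h3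
      refine ht ?_
      rcases mem_uIoc.1 h3 with h | h
      · exact ⟨h1.1.trans h.1.le, h.2.trans h2.2⟩
      · exact ⟨h2.1.trans h.1.le, h.2.trans h1.2⟩
    rw [this]
    exact zero_le

theorem HasUniformFlow.exists_norm_sq_le [IsProbabilityMeasure μ] {T : Kernel E E}
    [IsMarkovKernel T] {hT : T.Invariant μ} (h : HasUniformFlow (markovOp T hT)) {r : ℝ}
    (hr : 0 < r) : ∃ a : ℝ, 0 ≤ a ∧ ∀ f ∈ L2zero μ, ENNReal.ofReal (‖f‖ ^ 2) ≤
      ENNReal.ofReal (a * dirichletForm (markovOp T hT) f) + ENNReal.ofReal r * oscSq μ f := by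
  obtain ⟨C, hC0, hC⟩ := measure_separated_le h hr
  -- The constant of Young's inequality `d C u ≤ C² u² / (4r) + r d²` with `d = M - m`. Its `r d²`
  -- and the one from the co-area comparison add up to `2 r d²`, matching the factor in `2‖f‖²`.
  refine ⟨C ^ 2 / (4 * r), by positivity, fun f hf => ?_⟩
  by_cases htop : oscSq μ f = ∞
  · rw [htop, ENNReal.mul_top (by simpa using hr)]
    simp
  obtain ⟨m, M, hmM, hb, he⟩ := exists_bounds_of_oscSq_ne_top htop
  have hd : 0 ≤ M - m := sub_nonneg.2 hmM
  have hE := dirichletForm_nonneg T hT f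
  rw [he, ← ENNReal.ofReal_mul hr.le, ← ENNReal.ofReal_add (by positivity) (by positivity)]
  refine ENNReal.ofReal_le_ofReal ?_
  have habs : ∀ {ρ : Measure (E × E)} [IsFiniteMeasure ρ], MeasurePreserving Prod.fst ρ μ →
      MeasurePreserving Prod.snd ρ μ → Integrable (fun p : E × E => |f p.1 - f p.2|) ρ :=
    fun h₁ h₂ => ((((Lp.memLp f).comp_measurePreserving h₁).sub
      ((Lp.memLp f).comp_measurePreserving h₂)).integrable (by norm_num)).abs
  have q1 := measurePreserving_fst_prod (μ := μ)
  have q2 := measurePreserving_snd_prod (μ := μ)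
  have p1 := measurePreserving_fst_compProd (μ := μ) T
  have p2 := measurePreserving_snd_compProd T hT
  have hI0 : 0 ≤ ∫ p, |f p.1 - f p.2| ∂(μ ⊗ₘ T) := integral_nonneg fun _ => abs_nonneg _
  have main : ∫ p, |f p.1 - f p.2| ∂(μ.prod μ) ≤
      C * ∫ p, |f p.1 - f p.2| ∂(μ ⊗ₘ T) + r * (M - m) := by
    have h1 := lintegral_prod_abs_sub_le hC (Lp.stronglyMeasurable f).measurable hb
    rw [← ofReal_integral_eq_lintegral_ofReal (habs q1 q2) (.of_forall fun _ => abs_nonneg _),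
      ← ofReal_integral_eq_lintegral_ofReal (habs p1 p2) (.of_forall fun _ => abs_nonneg _),
      ← ENNReal.ofReal_mul hC0.le, ← ENNReal.ofReal_mul hr.le,
      ← ENNReal.ofReal_add (by positivity) (by positivity)] at h1
    exact (ENNReal.ofReal_le_ofReal_iff (by positivity)).1 h1
  have hvar : 2 * ‖f‖ ^ 2 ≤ (M - m) * ∫ p, |f p.1 - f p.2| ∂(μ.prod μ) := by
    rw [two_mul_norm_sq hf, ← integral_const_mul]
    refine integral_mono_ae (integrable_coupling_sq_sub q1 q2 (Lp.memLp f))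
      ((habs q1 q2).const_mul _) ?_
    filter_upwards [q1.quasiMeasurePreserving.ae hb, q2.quasiMeasurePreserving.ae hb] with p h1 h2
    have h3 : |f p.1 - f p.2| ≤ M - m :=
      abs_le.2 ⟨by linarith [h1.1, h2.2], by linarith [h1.2, h2.1]⟩
    change (f p.1 - f p.2) ^ 2 ≤ (M - m) * |f p.1 - f p.2|
    rw [← sq_abs, sq]
    exact mul_le_mul_of_nonneg_right h3 (abs_nonneg _)
  have henergy : (M - m) * C * ∫ p, |f p.1 - f p.2| ∂(μ ⊗ₘ T) ≤
      C ^ 2 / (4 * r) * (2 * dirichletForm (markovOp T hT) f) + r * (M - m) ^ 2 := by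
    rw [two_mul_dirichletForm, ← integral_const_mul, ← integral_const_mul]
    have hsq := (integrable_coupling_sq_sub p1 p2 (Lp.memLp f)).const_mul (C ^ 2 / (4 * r))
    calc ∫ p, (M - m) * C * |f p.1 - f p.2| ∂(μ ⊗ₘ T)
        ≤ ∫ p, (C ^ 2 / (4 * r) * (f p.1 - f p.2) ^ 2 + r * (M - m) ^ 2) ∂(μ ⊗ₘ T) := by
          refine integral_mono ((habs p1 p2).const_mul _) (hsq.add (integrable_const _))
            fun p => ?_
          change (M - m) * C * |f p.1 - f p.2| ≤
            C ^ 2 / (4 * r) * (f p.1 - f p.2) ^ 2 + r * (M - m) ^ 2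
          rw [← sq_abs (f p.1 - f p.2)]
          have e : C ^ 2 / (4 * r) * |f p.1 - f p.2| ^ 2 + r * (M - m) ^ 2 -
              (M - m) * C * |f p.1 - f p.2| =
                (C * |f p.1 - f p.2| - 2 * r * (M - m)) ^ 2 / (4 * r) := by
            field_simp
            ring
          have : 0 ≤ (C * |f p.1 - f p.2| - 2 * r * (M - m)) ^ 2 / (4 * r) := by positivity
          linarith
      _ = _ := by
          rw [integral_add hsq (integrable_const _)]
          simp
  have := mul_le_mul_of_nonneg_left main hd
  nlinarith

/-! ### Centred indicators as test functions -/

/-- The centred indicator `1_A - μ(A)`. -/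
noncomputable def centeredInd (μ : Measure E) [IsProbabilityMeasure μ] {A : Set E}
    (hA : MeasurableSet A) : Lp ℝ 2 μ :=
  ind μ hA - μ.real A • ind μ MeasurableSet.univ

theorem coeFn_centeredInd [IsProbabilityMeasure μ] {A : Set E} (hA : MeasurableSet A) :
    centeredInd μ hA =ᵐ[μ] fun x => A.indicator 1 x - μ.real A := by
  filter_upwards [Lp.coeFn_sub (ind μ hA) (μ.real A • ind μ MeasurableSet.univ), coeFn_ind hA,
    Lp.coeFn_smul (μ.real A) (ind μ (MeasurableSet.univ (α := E))),
    coeFn_ind (μ := μ) (MeasurableSet.univ (α := E))] with x h1 h2 h3 h4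
  rw [centeredInd, h1, Pi.sub_apply, h2, h3, Pi.smul_apply, h4]
  simp

theorem inner_ind_ind [IsProbabilityMeasure μ] {A B : Set E} (hA : MeasurableSet A)
    (hB : MeasurableSet B) : ⟪ind μ hA, ind μ hB⟫ = μ.real (A ∩ B) := by
  rw [ind, ind, L2.inner_indicatorConstLp_indicatorConstLp]
  simp

theorem centeredInd_mem_L2zero [IsProbabilityMeasure μ] {A : Set E} (hA : MeasurableSet A) :
    centeredInd μ hA ∈ L2zero μ := by
  change ∫ x, centeredInd μ hA x ∂μ = 0
  have hi : Integrable (A.indicator (1 : E → ℝ)) μ := (integrable_const (1 : ℝ)).indicator hA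
  rw [integral_congr_ae (coeFn_centeredInd hA), integral_sub hi (integrable_const _),
    integral_indicator_one hA]
  simp

theorem norm_centeredInd_sq [IsProbabilityMeasure μ] {A : Set E} (hA : MeasurableSet A) :
    ‖centeredInd μ hA‖ ^ 2 = μ.real A * μ.real Aᶜ := by
  rw [← real_inner_self_eq_norm_sq, centeredInd, inner_sub_left, inner_sub_right, inner_sub_right,
    real_inner_smul_left, real_inner_smul_left, real_inner_smul_right, real_inner_smul_right,
    inner_ind_ind, inner_ind_ind, inner_ind_ind, inner_ind_ind, probReal_compl_eq_one_sub hA]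
  simp
  ring

/-- Both values of the indicator are taken on sets of positive mass, so any essential bounds must be
at least 1 apart. -/
theorem oscSq_centeredInd [IsProbabilityMeasure μ] {A : Set E} (hA : MeasurableSet A)
    (h0 : 0 < μ.real A) (h1 : 0 < μ.real Aᶜ) : oscSq μ (centeredInd μ hA) = 1 := by
  have hb : ∀ᵐ x ∂μ, -μ.real A ≤ centeredInd μ hA x ∧ centeredInd μ hA x ≤ 1 - μ.real A := by
    filter_upwards [coeFn_centeredInd hA] with x hx
    rw [hx]
    by_cases h : x ∈ A <;> simp [h]
  have hle := oscNorm_le_ofReal hb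
  rw [sub_neg_eq_add, sub_add_cancel, ENNReal.ofReal_one] at hle
  obtain ⟨m, M, hmM, hb', he⟩ :=
    exists_bounds_of_oscNorm_ne_top (ne_top_of_le_ne_top ENNReal.one_ne_top hle)
  have hex : ∀ B : Set E, 0 < μ.real B → ∃ x ∈ B, (m ≤ centeredInd μ hA x ∧
      centeredInd μ hA x ≤ M) ∧ centeredInd μ hA x = A.indicator 1 x - μ.real A := by
    intro B hB
    have hB' : μ B ≠ 0 := fun h => by simp [measureReal_def, h] at hB
    have hf : ∃ᵐ x ∂μ, x ∈ B := frequently_ae_mem_iff.2 hB'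
    exact (hf.and_eventually (hb'.and (coeFn_centeredInd hA))).exists
  obtain ⟨x, hxA, hx, hxe⟩ := hex A h0
  obtain ⟨y, hyA, hy, hye⟩ := hex Aᶜ h1
  rw [indicator_of_mem hxA, Pi.one_apply] at hxe
  rw [indicator_of_notMem hyA] at hye
  have hge : (1 : ℝ≥0∞) ≤ oscNorm μ (centeredInd μ hA) := by
    rw [he, ← ENNReal.ofReal_one]
    exact ENNReal.ofReal_le_ofReal (by linarith [hx.2, hy.1])
  rw [oscSq, le_antisymm hle hge, one_pow]

/-- Constants do not contribute to the energy, and `1_A - T 1_A` pairs with `1_A` as `T 1_{Aᶜ}`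
does, because `T 1 = 1`. -/
theorem dirichletForm_centeredInd [IsProbabilityMeasure μ] (T : Kernel E E) [IsMarkovKernel T]
    (hT : T.Invariant μ) {A : Set E} (hA : MeasurableSet A) :
    dirichletForm (markovOp T hT) (centeredInd μ hA) =
      ⟪ind μ hA, markovOp T hT (ind μ hA.compl)⟫ := by
  have h1 : dirichletForm (markovOp T hT) (centeredInd μ hA) =
      dirichletForm (markovOp T hT) (ind μ hA) := by
    refine mul_left_cancel₀ (two_ne_zero' ℝ) ?_
    rw [two_mul_dirichletForm, two_mul_dirichletForm]
    refine integral_congr_ae ?_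
    have hc : ∀ᵐ x ∂μ, centeredInd μ hA x = ind μ hA x - μ.real A := by
      filter_upwards [coeFn_centeredInd hA, coeFn_ind hA] with x h1 h2
      rw [h1, h2]
    filter_upwards [(measurePreserving_fst_compProd T).quasiMeasurePreserving.ae hc,
      (measurePreserving_snd_compProd T hT).quasiMeasurePreserving.ae hc] with p h1 h2
    rw [h1, h2]
    ring
  rw [h1, dirichletForm, inner_sub_left, ← sub_eq_of_eq_add' (ind_add_ind_compl hA).symm, map_sub,
    markovOp_ind_univ, inner_sub_right, inner_ind_ind, inner_ind_ind, inter_self, inter_univ,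
    real_inner_comm]

theorem ofReal_le_of_centeredInd [IsProbabilityMeasure μ] {T : Kernel E E} [IsMarkovKernel T]
    {hT : T.Invariant μ} {s b : ℝ} (hs : 0 ≤ s) (hb : 0 ≤ b)
    (h : ∀ f ∈ L2zero μ, ENNReal.ofReal (‖f‖ ^ 2) ≤
      ENNReal.ofReal (s * dirichletForm (markovOp T hT) f) + ENNReal.ofReal b * oscSq μ f)
    {A : Set E} (hA : MeasurableSet A) (h0 : 0 < μ.real A) (h1 : 0 < μ.real Aᶜ) :
    μ.real A * μ.real Aᶜ ≤ s * ⟪ind μ hA, markovOp T hT (ind μ hA.compl)⟫ + b := by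
  have hE := dirichletForm_nonneg T hT (centeredInd μ hA)
  have h2 := h _ (centeredInd_mem_L2zero hA)
  rw [oscSq_centeredInd hA h0 h1, mul_one, ← ENNReal.ofReal_add (mul_nonneg hs hE) hb,
    ENNReal.ofReal_le_ofReal_iff (add_nonneg (mul_nonneg hs hE) hb), norm_centeredInd_sq,
    dirichletForm_centeredInd] at h2
  exact h2

theorem HasUniformFlow.of_forall_exists [IsProbabilityMeasure μ] {T : Kernel E E}
    [IsMarkovKernel T] {hT : T.Invariant μ}
    (h : ∀ r : ℝ, 0 < r → ∃ s b : ℝ, 0 ≤ s ∧ 0 ≤ b ∧ b ≤ r ∧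
      ∀ f ∈ L2zero μ, ENNReal.ofReal (‖f‖ ^ 2) ≤
        ENNReal.ofReal (s * dirichletForm (markovOp T hT) f) + ENNReal.ofReal b * oscSq μ f) :
    HasUniformFlow (markovOp T hT) := by
  intro ε hε
  obtain ⟨s, b, hs, hb, hbr, H⟩ := h (ε ^ 2 / 2) (by positivity)
  -- Half of `μ(A)μ(Aᶜ) ≥ ε²` survives the error `b ≤ ε² / 2`; `s + 1` avoids division by zero.
  refine ⟨ε ^ 2 / 2 / (s + 1), by positivity, fun A hA h2 h3 => ?_⟩
  have h4 := ofReal_le_of_centeredInd hs hb H hA (hε.trans_le h2) (hε.trans_le h3)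
  have h5 : 0 ≤ ⟪ind μ hA, markovOp T hT (ind μ hA.compl)⟫ := by
    rw [inner_ind_markovOp_ind]; exact measureReal_nonneg
  have h6 : ε * ε ≤ μ.real A * μ.real Aᶜ := mul_le_mul h2 h3 hε.le (hε.le.trans h2)
  rw [div_le_iff₀ (by positivity)]
  linarith

/-! ### The three parametrizations -/

theorem alphaWPI_iff_hasUniformFlow [IsProbabilityMeasure μ] (T : Kernel E E) [IsMarkovKernel T]
    (hT : T.Invariant μ) :
    (∃ α : ℝ → ℝ, AlphaWPI (markovOp T hT) (oscSq μ) α) ↔ HasUniformFlow (markovOp T hT) := by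
  constructor
  · rintro ⟨α, h0, -, h⟩
    exact .of_forall_exists fun r hr => ⟨α r, r, h0 r hr, hr.le, le_rfl, h r hr⟩
  · intro h
    let S : ℝ → Set ℝ := fun r => {a | 0 ≤ a ∧ ∀ f ∈ L2zero μ, ENNReal.ofReal (‖f‖ ^ 2) ≤
      ENNReal.ofReal (a * dirichletForm (markovOp T hT) f) + ENNReal.ofReal r * oscSq μ f}
    have hne : ∀ r, 0 < r → (S r).Nonempty := fun r hr => h.exists_norm_sq_le hr
    have hbd : ∀ r, BddBelow (S r) := fun r => ⟨0, fun a ha => ha.1⟩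
    have hmono : ∀ r r', r ≤ r' → S r ⊆ S r' := fun r r' hr a ha =>
      ⟨ha.1, fun f hf => (ha.2 f hf).trans (by gcongr)⟩
    -- Taking the infimum of admissible constants makes the choice monotone in `r`; the added 1
    -- avoids proving that the infimum is attained.
    refine ⟨fun r => sInf (S r) + 1, fun r hr => ?_, fun r hr r' hr' hrr' => ?_,
      fun r hr f hf => ?_⟩
    · exact add_nonneg (Real.sInf_nonneg fun a ha => ha.1) zero_le_one
    · exact add_le_add_left (csInf_le_csInf (hbd r') (hne r hr) (hmono r r' hrr')) 1
    · obtain ⟨a, ha, hlt⟩ := Real.lt_sInf_add_pos (hne r hr) one_pos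
      refine (ha.2 f hf).trans ?_
      have := dirichletForm_nonneg T hT f
      gcongr

theorem HasUniformFlow.exists_betaWPI [IsProbabilityMeasure μ] {T : Kernel E E} [IsMarkovKernel T]
    {hT : T.Invariant μ} (h : HasUniformFlow (markovOp T hT)) :
    ∃ β : ℝ → ℝ, BetaWPI (markovOp T hT) (oscSq μ) β := by
  let S : ℝ → Set ℝ := fun s => {b | 0 ≤ b ∧ ∀ f ∈ L2zero μ, ENNReal.ofReal (‖f‖ ^ 2) ≤
    ENNReal.ofReal (s * dirichletForm (markovOp T hT) f) + ENNReal.ofReal b * oscSq μ f}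
  have hne : ∀ s, (S s).Nonempty := fun s => ⟨1, zero_le_one, fun f hf =>
    (norm_sq_le_oscSq hf).trans (by simp)⟩
  have hbd : ∀ s, BddBelow (S s) := fun s => ⟨0, fun a ha => ha.1⟩
  have hmono : ∀ s s', s ≤ s' → S s ⊆ S s' := fun s s' hs b hb =>
    ⟨hb.1, fun f hf => (hb.2 f hf).trans (by
      have := dirichletForm_nonneg T hT f
      gcongr)⟩
  have h0 : ∀ s, 0 ≤ sInf (S s) := fun s => Real.sInf_nonneg fun a ha => ha.1
  -- The slack above the infimum must itself decrease to 0, hence `s⁻¹`.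
  refine ⟨fun s => sInf (S s) + s⁻¹, fun s hs => add_nonneg (h0 s) (inv_nonneg.2 hs.le),
    fun s hs s' hs' hss' => ?_, ?_, fun s hs f hf => ?_⟩
  · exact add_le_add (csInf_le_csInf (hbd s') (hne s) (hmono s s' hss'))
      (inv_anti₀ hs hss')
  · have hlim : Filter.Tendsto (fun s => sInf (S s)) Filter.atTop (nhds 0) := by
      rw [Metric.tendsto_atTop]
      intro ε hε
      obtain ⟨a, -, ha⟩ := h.exists_norm_sq_le (half_pos hε)
      refine ⟨a, fun s hs => ?_⟩
      rw [Real.dist_eq, sub_zero, abs_of_nonneg (h0 s)]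
      have : ε / 2 ∈ S a := ⟨(half_pos hε).le, ha⟩
      exact (csInf_le (hbd s) (hmono a s hs this)).trans_lt (half_lt_self hε)
    simpa using hlim.add tendsto_inv_atTop_zero
  · obtain ⟨b, hb, hlt⟩ := Real.lt_sInf_add_pos (hne s) (inv_pos.2 hs)
    exact (hb.2 f hf).trans (by gcongr)

theorem BetaWPI.hasUniformFlow [IsProbabilityMeasure μ] {T : Kernel E E} [IsMarkovKernel T]
    {hT : T.Invariant μ} {β : ℝ → ℝ} (h : BetaWPI (markovOp T hT) (oscSq μ) β) :
    HasUniformFlow (markovOp T hT) := by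
  obtain ⟨h0, -, hlim, h⟩ := h
  refine .of_forall_exists fun r hr => ?_
  obtain ⟨s, hs, hs0⟩ :=
    ((hlim.eventually (gt_mem_nhds hr)).and (Filter.eventually_gt_atTop 0)).exists
  exact ⟨s, β s, hs0.le, h0 s hs0, hs.le, h s hs0⟩

theorem betaWPI_iff_hasUniformFlow [IsProbabilityMeasure μ] (T : Kernel E E) [IsMarkovKernel T]
    (hT : T.Invariant μ) :
    (∃ β : ℝ → ℝ, BetaWPI (markovOp T hT) (oscSq μ) β) ↔ HasUniformFlow (markovOp T hT) :=
  ⟨fun ⟨_, h⟩ => h.hasUniformFlow, fun h => h.exists_betaWPI⟩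

/-- Solving the inequality for the energy bounds it below by `(v - β(s)) / s` for every `s`, with
`v` the ratio of squared norm to sieve. The supremum over positive integers `s` is convex as a
supremum of affine functions, and positive for `v > 0` because `β → 0`. -/
theorem BetaWPI.exists_kStarWPI [IsProbabilityMeasure μ] {T : Kernel E E} [IsMarkovKernel T]
    {hT : T.Invariant μ} {β : ℝ → ℝ} (h : BetaWPI (markovOp T hT) (oscSq μ) β) :
    ∃ K : ℝ → ℝ, KStarWPI (markovOp T hT) (oscSq μ) K := by
  obtain ⟨h0, -, hlim, h⟩ := h
  have hpos : ∀ n : ℕ, (0 : ℝ) < n + 1 := fun n => by positivity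
  let k : ℝ → ℕ → ℝ := fun v n => (v - β (n + 1)) / (n + 1)
  have hle : ∀ v, 0 ≤ v → ∀ n, k v n ≤ v := fun v hv n => by
    rw [div_le_iff₀ (hpos n)]
    nlinarith [h0 _ (hpos n), mul_nonneg hv (Nat.cast_nonneg (α := ℝ) n)]
  have hbdd : ∀ v, 0 ≤ v → BddAbove (range (k v)) := fun v hv =>
    ⟨v, by rintro _ ⟨n, rfl⟩; exact hle v hv n⟩
  let K : ℝ → ℝ := fun v => ⨆ n, k v n
  have hcast : Filter.Tendsto (fun n : ℕ => (n : ℝ) + 1) Filter.atTop Filter.atTop :=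
    Filter.tendsto_atTop_add_const_right _ 1 tendsto_natCast_atTop_atTop
  have hK0 : K 0 = 0 := by
    refine le_antisymm (ciSup_le fun n => hle 0 le_rfl n) ?_
    have h1 : Filter.Tendsto (k 0) Filter.atTop (nhds 0) := by
      have := (hlim.comp hcast).neg.mul (tendsto_inv_atTop_zero.comp hcast)
      rw [neg_zero, zero_mul] at this
      refine this.congr fun n => ?_
      simp [k, div_eq_mul_inv]
    exact le_of_tendsto' h1 fun n => le_ciSup (hbdd 0 le_rfl) n
  have hKpos : ∀ v, 0 < v → 0 < K v := by
    intro v hv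
    obtain ⟨n, hn⟩ := ((hlim.comp hcast).eventually (gt_mem_nhds hv)).exists
    exact (div_pos (sub_pos.2 hn) (hpos n)).trans_le (le_ciSup (hbdd v hv.le) n)
  have hconv : ∀ u v a b : ℝ, 0 ≤ u → 0 ≤ v → 0 ≤ a → 0 ≤ b → a + b = 1 →
      K (a * u + b * v) ≤ a * K u + b * K v := by
    intro u v a b hu hv ha hb hab
    refine ciSup_le fun n => ?_
    have e : k (a * u + b * v) n = a * k u n + b * k v n := by
      simp only [k]
      field_simp
      linear_combination β (n + 1) * hab
    rw [e]
    exact add_le_add (mul_le_mul_of_nonneg_left (le_ciSup (hbdd u hu) n) ha)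
      (mul_le_mul_of_nonneg_left (le_ciSup (hbdd v hv) n) hb)
  -- Convexity with `K 0 = 0` gives `K u ≤ (u / v) K v`, and `K v > 0`.
  have hstrict : ∀ u v : ℝ, 0 ≤ u → u < v → K u < K v := by
    intro u v hu huv
    have hv : 0 < v := hu.trans_lt huv
    have h1 := hconv v 0 (u / v) (1 - u / v) hv.le le_rfl (by positivity)
      (sub_nonneg.2 ((div_le_one hv).2 huv.le)) (by ring)
    rw [div_mul_cancel₀ _ hv.ne', mul_zero, add_zero, hK0, mul_zero, add_zero] at h1
    exact h1.trans_lt (mul_lt_of_lt_one_left (hKpos v hv) ((div_lt_one hv).2 huv))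
  refine ⟨K, fun v hv => ?_, ⟨convex_Icc _ _, fun u hu v hv a b ha hb hab => ?_⟩,
    fun u hu v _ huv => hstrict u v hu.1 huv, hK0, fun f hf hΨ0 hΨ => ?_⟩
  · rcases hv.1.eq_or_lt with h | h
    · rw [← h, hK0]
    · exact (hKpos v h).le
  · exact hconv u v a b hu.1 hv.1 ha hb hab
  · have hΨr : 0 < (oscSq μ f).toReal := ENNReal.toReal_pos hΨ0.ne' hΨ.ne
    have hE := dirichletForm_nonneg T hT f
    refine ciSup_le fun n => ?_
    have h1 := h (n + 1) (hpos n) f hf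
    rw [← ENNReal.ofReal_toReal hΨ.ne, ← ENNReal.ofReal_mul (h0 _ (hpos n)),
      ← ENNReal.ofReal_add (mul_nonneg (hpos n).le hE) (mul_nonneg (h0 _ (hpos n)) hΨr.le),
      ENNReal.ofReal_le_ofReal_iff (add_nonneg (mul_nonneg (hpos n).le hE)
        (mul_nonneg (h0 _ (hpos n)) hΨr.le))] at h1
    rw [div_le_div_iff₀ (hpos n) hΨr, sub_mul, div_mul_cancel₀ _ hΨr.ne']
    linarith

theorem KStarWPI.hasUniformFlow [IsProbabilityMeasure μ] {T : Kernel E E} [IsMarkovKernel T]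
    {hT : T.Invariant μ} {K : ℝ → ℝ} (h : KStarWPI (markovOp T hT) (oscSq μ) K) :
    HasUniformFlow (markovOp T hT) := by
  obtain ⟨-, -, hmono, hK0, h⟩ := h
  intro ε hε
  have hsub : ∀ (A : Set E), MeasurableSet A → ε ≤ μ.real A → ε ≤ μ.real Aᶜ →
      ε ^ 2 ≤ μ.real A * μ.real Aᶜ ∧ μ.real A * μ.real Aᶜ ≤ (sieveConst (oscSq μ)).toReal := by
    intro A hA h1 h2
    have hA0 := hε.trans_le h1
    have hA1 := hε.trans_le h2
    refine ⟨by rw [sq]; exact mul_le_mul h1 h2 hε.le hA0.le, ?_⟩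
    rw [← ENNReal.ofReal_le_iff_le_toReal sieveConst_oscSq_ne_top]
    have hne : centeredInd μ hA ≠ 0 := fun h0 => by
      have := norm_centeredInd_sq (μ := μ) hA
      rw [h0, norm_zero, zero_pow two_ne_zero] at this
      exact (mul_pos hA0 hA1).ne this
    refine le_trans (le_of_eq ?_) (le_iSup₂_of_le (centeredInd μ hA)
      ⟨centeredInd_mem_L2zero hA, hne⟩ le_rfl)
    rw [norm_centeredInd_sq, oscSq_centeredInd hA hA0 hA1, div_one]
  -- Outside `[0, 𝔞]` nothing is known about `K`; but if `ε² > 𝔞`, no set `A` meets the mass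
  -- conditions and any constant serves.
  by_cases hle : ε ^ 2 ≤ (sieveConst (oscSq μ)).toReal
  · have hmem : ε ^ 2 ∈ Icc 0 (sieveConst (oscSq μ)).toReal := ⟨by positivity, hle⟩
    refine ⟨K (ε ^ 2), ?_, fun A hA h1 h2 => ?_⟩
    · rw [← hK0]
      exact hmono (left_mem_Icc.2 (hmem.1.trans hle)) hmem (by positivity)
    · obtain ⟨h3, h4⟩ := hsub A hA h1 h2
      have h5 := h _ (centeredInd_mem_L2zero hA)
      rw [oscSq_centeredInd hA (hε.trans_le h1) (hε.trans_le h2)] at h5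
      have h6 := h5 one_pos ENNReal.one_lt_top
      rw [ENNReal.toReal_one, div_one, div_one, norm_centeredInd_sq,
        dirichletForm_centeredInd] at h6
      exact (hmono.monotoneOn hmem ⟨hmem.1.trans h3, h4⟩ h3).trans h6
  · exact ⟨1, one_pos, fun A hA h1 h2 =>
      absurd ((hsub A hA h1 h2).1.trans (hsub A hA h1 h2).2) hle⟩

theorem kStarWPI_iff_hasUniformFlow [IsProbabilityMeasure μ] (T : Kernel E E) [IsMarkovKernel T]
    (hT : T.Invariant μ) :
    (∃ K : ℝ → ℝ, KStarWPI (markovOp T hT) (oscSq μ) K) ↔ HasUniformFlow (markovOp T hT) :=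
  ⟨fun ⟨_, h⟩ => h.hasUniformFlow, fun h => by
    obtain ⟨_, hβ⟩ := h.exists_betaWPI
    exact hβ.exists_kStarWPI⟩

theorem isRUPI_iff_hasUniformFlow [IsProbabilityMeasure μ] (T : Kernel E E) [IsMarkovKernel T]
    (hT : T.Invariant μ) : IsRUPI (markovOp T hT) ↔ HasUniformFlow (markovOp T hT) :=
  ⟨fun ⟨_, h0, h1, h⟩ => .of_isUPI_resolventOp h0 h1 h, fun h =>
    ⟨1 / 2, by norm_num, by norm_num, h.isUPI_resolventOp (by norm_num) (by norm_num)⟩⟩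

end WeakPoincare

theorem mainTheorem2 {E : Type*} [MeasurableSpace E] (μ : Measure E) [IsProbabilityMeasure μ]
    (T : Kernel E E) [IsMarkovKernel T] (hT : T.Invariant μ) :
    ((∃ α : ℝ → ℝ, WeakPoincare.AlphaWPI (WeakPoincare.markovOp T hT) (WeakPoincare.oscSq μ) α) ↔
      WeakPoincare.IsRUPI (WeakPoincare.markovOp T hT)) ∧
    ((∃ β : ℝ → ℝ, WeakPoincare.BetaWPI (WeakPoincare.markovOp T hT) (WeakPoincare.oscSq μ) β) ↔
      WeakPoincare.IsRUPI (WeakPoincare.markovOp T hT)) ∧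
    ((∃ K : ℝ → ℝ, WeakPoincare.KStarWPI (WeakPoincare.markovOp T hT) (WeakPoincare.oscSq μ) K) ↔
      WeakPoincare.IsRUPI (WeakPoincare.markovOp T hT)) ∧
    (WeakPoincare.IsRUPI (WeakPoincare.markovOp T hT) ↔
      ∀ l : ℝ, 0 < l → l < 1 →
        WeakPoincare.IsUPI (WeakPoincare.resolventOp l (WeakPoincare.markovOp T hT))) := by
  rw [WeakPoincare.alphaWPI_iff_hasUniformFlow, WeakPoincare.betaWPI_iff_hasUniformFlow,
    WeakPoincare.kStarWPI_iff_hasUniformFlow, WeakPoincare.isRUPI_iff_hasUniformFlow]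
  exact ⟨Iff.rfl, Iff.rfl, Iff.rfl, fun h l h0 h1 => h.isUPI_resolventOp h0 h1, fun h =>
    .of_isUPI_resolventOp one_half_pos one_half_lt_one (h (1 / 2) one_half_pos one_half_lt_one)⟩
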